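/- Let $\mathcal S$ and $\mathcal A\neq\emptyset$ be finite sets, $P_0$ a probability distribution on $\mathcal S$, $P^a_{s,s'}$ transition probabilities on $\mathcal S$ for each $a\in\mathcal A$, $r_{s,s'}(a)\in\mathbb R$ a reward function, $\gamma\in[0,1)$ and $\beta\ge 0$. A controlled process $s_t$ starts from $s_0\sim P_0$. At each time $t=0,1,2,\dots$ an encoder first chooses $c_t\in\{0,1\}$; the decoder then observes $o_t=s_t$ if $c_t=1$ (transmission) and $o_t=\chi\notin\mathcal S$ if $c_t=0$, and chooses $a_t\in\mathcal A$; finally $s_{t+1}$ is drawn from $P^{a_t}_{s_t,\cdot}$. Policies are deterministic and causal: $c_t=\pi_{\mathrm e,t}(s_{0:t},c_{0:t-1},a_{0:t-1})$ and $a_t=\pi_{\mathrm d,t}(o_{0:t},a_{0:t-1})$. The common objective is to maximize $$J(\pi_{\mathrm e},\pi_{\mathrm d})=\mathbb E\Big[\sum_{t=0}^\infty\gamma^t\big(r_{s_t,s_{t+1}}(a_t)-\beta c_t\big)\Big].$$ Let $\Delta_t$ be the time elapsed at time $t$ since the last transmission and $s_{t-\Delta_t}$ the state transmitted then. For the encoder,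 which has yet to choose $c_t$, the last transmission is the last one before $t$ (so $\Delta_t\ge1$); for the decoder it is the last one up to and including $t$ (so $\Delta_t\ge 0$). As long as nothing has been transmitted, $\Delta_t=t+1$ and $s_{t-\Delta_t}$ is replaced by a symbol $\varnothing\notin\mathcal S$. Theorem. Without loss of optimality, the encoder's knowledge at each time $t$ can be reduced to $\langle s_t,\Delta_t,s_{t-\Delta_t}\rangle$ and the decoder's to $\langle\Delta_t,s_{t-\Delta_t}\rangle$. That is, there are time-independent maps $f:\mathcal S\times\mathbb N\times(\mathcal S\cup\{\varnothing\})\to\{0,1\}$ and $g:\mathbb N\times(\mathcal S\cup\{\varnothing\})\to\mathcal A$ such that the policies $c_t=f(s_t,\Delta_t,s_{t-\Delta_t})$, $a_t=g(\Delta_t,s_{t-\Delta_t})$ attain the maximum of $J$ over all pairs of deterministic causal policies. -/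

import Mathlib

open MeasureTheory ProbabilityTheory

namespace RemoteControl

/-- The data of the remote control problem: a controlled Markov chain on the state set `S` with
control actions in `A`, an initial law, a reward, a discount factor and a price per transmission.
Communication actions are Booleans (`true` means that the current state is transmitted), and the
observation set of the decoder is `Option S`, where `none` is the absence of transmission. -/
structure Model (S A : Type*) where
  /-- law of the initial state -/
  init : PMF S
  /-- `trans s a` is the law of the next state when action `a` is taken in state `s` -/
  trans : S → A → PMF S
  /-- `reward s a s'` is the reward of a move from `s` to `s'` under action `a` -/
  reward : S → A → S → ℝ
  /-- discount factor -/
  γ : ℝ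
  γ_nonneg : 0 ≤ γ
  γ_lt_one : γ < 1
  /-- price of one transmission -/
  β : ℝ
  β_nonneg : 0 ≤ β

/-- The decoder observation function. -/
def obs {S : Type*} (s : S) (c : Bool) : Option S := if c then some s else none

/-- Deterministic causal encoder policies: `c_t` is a function of all that has happened before it,
namely `s_0, …, s_t`, `c_0, …, c_{t-1}` and `a_0, …, a_{t-1}` (the past observations of the decoder
are functions of these). -/
abbrev EncPolicy (S A : Type*) :=
  (t : ℕ) → (Fin (t + 1) → S) → (Fin t → Bool) → (Fin t → A) → Bool

/-- Deterministic causal decoder policies: `a_t` is a function of the observations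
`o_0, …, o_t` and of the past control actions `a_0, …, a_{t-1}`. -/
abbrev DecPolicy (S A : Type*) :=
  (t : ℕ) → (Fin (t + 1) → Option S) → (Fin t → A) → A

section ClosedLoop

variable {S A : Type*}

/-- The communication action chosen at time `t` along the state sequence `ω`, given the past
communication actions `c` and control actions `a`. -/
def nextComm (e : EncPolicy S A) (ω : ℕ → S) (t : ℕ) (c : Fin t → Bool) (a : Fin t → A) : Bool :=
  e t (fun i => ω i) c a

/-- The control action chosen at time `t` along the state sequence `ω`, given the communication
actions `c` up to time `t` and the past control actions `a`. -/
def nextCtrl (d : DecPolicy S A) (ω : ℕ → S) (t : ℕ) (c : Fin (t + 1) → Bool) (a : Fin t → A) :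
    A :=
  d t (fun i => obs (ω i) (c i)) a

/-- The communication and control actions at the times `0, …, t - 1` along the state
sequence `ω`. At each time the encoder acts first and the decoder second. -/
def actions (e : EncPolicy S A) (d : DecPolicy S A) (ω : ℕ → S) :
    (t : ℕ) → (Fin t → Bool) × (Fin t → A)
  | 0 => (Fin.elim0, Fin.elim0)
  | t + 1 =>
    let h := actions e d ω t
    let c : Fin (t + 1) → Bool := Fin.snoc h.1 (nextComm e ω t h.1 h.2)
    (c, Fin.snoc h.2 (nextCtrl d ω t c h.2))

/-- The communication action `c_t` along the state sequence `ω`. -/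
def comm (e : EncPolicy S A) (d : DecPolicy S A) (ω : ℕ → S) (t : ℕ) : Bool :=
  (actions e d ω (t + 1)).1 (Fin.last t)

/-- The control action `a_t` along the state sequence `ω`. -/
def ctrl (e : EncPolicy S A) (d : DecPolicy S A) (ω : ℕ → S) (t : ℕ) : A :=
  (actions e d ω (t + 1)).2 (Fin.last t)

/-- A state sequence that extends the finite one `s_0, …, s_t` (by repeating the last entry;
the actions up to time `t` do not depend on how it is extended). -/
def extend {t : ℕ} (x : (i : Finset.Iic t) → S) : ℕ → S :=
  fun n => x ⟨min n t, Finset.mem_Iic.2 (min_le_right n t)⟩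

end ClosedLoop

section Value

variable {S A : Type*} [Finite S] [MeasurableSpace S] [MeasurableSingletonClass S]

/-- The conditional law of `s_{t+1}` given `s_0, …, s_t` under the policies `e` and `d`. -/
noncomputable def stepKernel (M : Model S A) (e : EncPolicy S A) (d : DecPolicy S A) (t : ℕ) :
    Kernel ((i : Finset.Iic t) → S) S :=
  Kernel.ofFunOfCountable fun x =>
    (M.trans (extend x t) (ctrl e d (extend x) t)).toMeasure

instance (M : Model S A) (e : EncPolicy S A) (d : DecPolicy S A) (t : ℕ) :
    IsMarkovKernel (stepKernel M e d t) :=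
  ⟨fun _ => PMF.toMeasure.isProbabilityMeasure _⟩

/-- The law of the state process `(s_t)` under the policies `e` and `d`. -/
noncomputable def law (M : Model S A) (e : EncPolicy S A) (d : DecPolicy S A) :
    Measure (ℕ → S) :=
  Kernel.trajMeasure (X := fun _ => S) M.init.toMeasure (stepKernel M e d)

/-- The objective: the expectation of `∑ t, γ ^ t * (r_t - β * c_t)`. -/
noncomputable def value (M : Model S A) (e : EncPolicy S A) (d : DecPolicy S A) : ℝ :=
  ∫ ω, ∑' t : ℕ, M.γ ^ t *
    (M.reward (ω t) (ctrl e d ω t) (ω (t + 1)) - M.β * (if comm e d ω t then 1 else 0))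
      ∂(law M e d)

end Value

section Reduced

variable {S A : Type*}

/-- The pair of the time elapsed since the last transmission and the last transmitted state, after
the observations `o_0, …, o_{n-1}`, as of time `n - 1`. As long as nothing has been transmitted the
second entry is `none`, and the elapsed time is counted from the time `-1`. -/
def lastUpdate : (n : ℕ) → (Fin n → Option S) → ℕ × Option S
  | 0, _ => (0, none)
  | n + 1, o =>
    match o (Fin.last n) with
    | some s => (0, some s)
    | none =>
      ((lastUpdate n fun i => o i.castSucc).1 + 1, (lastUpdate n fun i => o i.castSucc).2)

/-- The encoder policy that at each time `t` applies the map `f` to `s_t`, the time elapsed at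
time `t` since the last transmission before `t`, and the state transmitted then. -/
def reducedEnc (f : S → ℕ → Option S → Bool) : EncPolicy S A := fun t s c _ =>
  let u := lastUpdate t fun i => obs (s i.castSucc) (c i)
  f (s (Fin.last t)) (u.1 + 1) u.2

/-- The decoder policy that at each time `t` applies the map `g` to the time elapsed since the last
transmission up to and including time `t`, and the state transmitted then. -/
def reducedDec (g : ℕ → Option S → A) : DecPolicy S A := fun t o _ =>
  let u := lastUpdate (t + 1) o
  g u.1 u.2

end Reduced

end RemoteControl

open MeasureTheory ProbabilityTheory Filter Topology

namespace RemoteControl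

/-! ### Optimality equation on pairs (action sequence, state) -/

section FixedPoint

variable {S A : Type*} [Fintype S]

/-! During silence the decoder receives only blanks, so a deterministic decoder follows a plan: an
action sequence `α` fixed by the past. The pair (`α`, current state) is therefore a state for
dynamic programming, and no beliefs are needed. Silence shifts the plan; a transmission costs β and
lets the decoder adopt the best plan for the state just revealed. The resulting Bellman operator
contracts the continuous functions on the compact space of plans, and its fixed point `v` comes with
maximizing plans (`exists_optimality_equation`).

Along every path, under any policies, the decision at time t is worth at most `v` at the current
plan and state (`decisionValue_le`). Discounted telescoping bounds J by the mean of `v` at the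
initial plan, hence by its maximum over plans. Playing optimal plans and transmitting when this pays
reverses both bounds (`le_decisionValue_greedy`). These policies need only the last transmitted
state and its age, which determine the plan. -/

/-- Expected reward of the action `a` in the state `s`, followed by the continuation value `v` of
the action sequence `α`. -/
noncomputable def stepValue (M : Model S A) (v : (ℕ → A) → S → ℝ) (a : A) (α : ℕ → A) (s : S) : ℝ :=
  ∑ s', (M.trans s a s').toReal * (M.reward s a s' + M.γ * v α s')

/-- The value `stepValue` of applying the first entry of an action sequence and continuing with
the others. -/
noncomputable def seqValue (M : Model S A) (v : (ℕ → A) → S → ℝ) (α : ℕ → A) (s : S) : ℝ :=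
  stepValue M v (α 0) (fun k => α (k + 1)) s

lemma sum_toReal_pmf (p : PMF S) : ∑ s, (p s).toReal = 1 := by
  rw [← ENNReal.toReal_sum fun s _ => p.apply_ne_top s, ← tsum_fintype (L := .unconditional S),
    p.tsum_coe, ENNReal.toReal_one]

/-- Monotonicity plus discounting of constants (Blackwell's conditions): the source of the
contraction. -/
lemma seqValue_le_add (M : Model S A) {v w : (ℕ → A) → S → ℝ} {D : ℝ}
    (h : ∀ α s, v α s ≤ w α s + D) (α : ℕ → A) (s : S) :
    seqValue M v α s ≤ seqValue M w α s + M.γ * D := by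
  have key : seqValue M w α s + M.γ * D = ∑ s', (M.trans s (α 0) s').toReal *
      (M.reward s (α 0) s' + M.γ * (w (fun k => α (k + 1)) s' + D)) := by
    have := sum_toReal_pmf (M.trans s (α 0))
    calc _ = seqValue M w α s + (∑ s', (M.trans s (α 0) s').toReal) * (M.γ * D) := by
          rw [this, one_mul]
      _ = _ := by
          rw [seqValue, stepValue, Finset.sum_mul, ← Finset.sum_add_distrib]
          exact Finset.sum_congr rfl fun s' _ => by ring
  rw [key, seqValue, stepValue]
  have := M.γ_nonneg
  gcongr
  exact h _ _

lemma continuous_seqValue [TopologicalSpace A] [DiscreteTopology A] (M : Model S A)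
    {v : (ℕ → A) → S → ℝ} (hv : Continuous v) (s : S) :
    Continuous fun α => seqValue M v α s := by
  unfold seqValue stepValue
  refine continuous_finsetSum _ fun s' _ => ?_
  have h0 : Continuous fun α : ℕ → A => α 0 := continuous_apply 0
  have h1 : Continuous fun α : ℕ → A => v (fun k => α (k + 1)) s' :=
    (continuous_apply s').comp (hv.comp (continuous_pi fun k => continuous_apply (k + 1)))
  have h2 : Continuous fun α : ℕ → A => (M.trans s (α 0) s').toReal :=
    (continuous_of_discreteTopology (f := fun a => (M.trans s a s').toReal)).comp h0
  have h3 : Continuous fun α : ℕ → A => M.reward s (α 0) s' :=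
    (continuous_of_discreteTopology (f := fun a => M.reward s a s')).comp h0
  exact h2.mul (h3.add (continuous_const.mul h1))

/-- The optimality equation: `v α s` is the optimal value in state `s` before the encoder acts,
when the decoder is going to play `α` until the next transmission, and `star s` is an optimal
action sequence from a transmission of `s` on. -/
theorem exists_optimality_equation [Finite A] [Nonempty A] (M : Model S A) :
    ∃ (v : (ℕ → A) → S → ℝ) (star : S → ℕ → A) (start : ℕ → A),
      (∃ C, ∀ α s, |v α s| ≤ C) ∧
      (∀ α s, v α s = max (seqValue M v (star s) s - M.β) (seqValue M v α s)) ∧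
      (∀ α s, seqValue M v α s ≤ seqValue M v (star s) s) ∧
      ∀ α, ∑ s, (M.init s).toReal * v α s ≤ ∑ s, (M.init s).toReal * v start s := by
  classical
  -- With `A` finite and discrete, the space of plans is compact, so continuous functions on it
  -- attain their maxima.
  let _ : TopologicalSpace A := ⊥
  have : DiscreteTopology A := ⟨rfl⟩
  have hmax : ∀ F : (ℕ → A) → ℝ, Continuous F → ∃ α, ∀ α', F α' ≤ F α := fun F hF => by
    obtain ⟨α, -, h⟩ := isCompact_univ.exists_isMaxOn Set.univ_nonempty hF.continuousOn
    exact ⟨α, fun α' => h (Set.mem_univ α')⟩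
  choose star hstar using fun (v : C(ℕ → A, S → ℝ)) (s : S) =>
    hmax _ (continuous_seqValue M v.continuous s)
  let T : C(ℕ → A, S → ℝ) → C(ℕ → A, S → ℝ) := fun v =>
    ⟨fun α s => max (seqValue M v (star v s) s - M.β) (seqValue M v α s),
      continuous_pi fun s => continuous_const.max (continuous_seqValue M v.continuous s)⟩
  have hT : ∀ v w α s, T v α s ≤ T w α s + M.γ * dist v w := fun v w α s => by
    have h : ∀ α s, v α s ≤ w α s + dist v w := fun α s => by
      have h1 := (dist_le_pi_dist (v α) (w α) s).trans (ContinuousMap.dist_apply_le_dist α)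
      rw [Real.dist_eq] at h1
      linarith [le_abs_self (v α s - w α s)]
    have h1 := seqValue_le_add M h (star v s) s
    have h2 := seqValue_le_add M h α s
    -- The best plan for `v` is merely a candidate for `w`.
    have h3 := hstar w s (star v s)
    change max _ _ ≤ max (seqValue M w (star w s) s - M.β) (seqValue M w α s) + _
    rw [max_add]
    exact max_le_max (by linarith) h2
  have hc : ContractingWith ⟨M.γ, M.γ_nonneg⟩ T := by
    refine ⟨by exact_mod_cast M.γ_lt_one, LipschitzWith.of_dist_le_mul fun v w => ?_⟩
    have h0 : 0 ≤ M.γ * dist v w := mul_nonneg M.γ_nonneg dist_nonneg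
    refine (ContinuousMap.dist_le h0).2 fun α => (dist_pi_le_iff h0).2 fun s => ?_
    have h1 := hT v w α s
    have h2 := hT w v α s
    rw [dist_comm w v] at h2
    rw [Real.dist_eq, abs_le]
    constructor <;> linarith
  set v := hc.fixedPoint with hv
  have hfix : T v = v := hc.fixedPoint_isFixedPt
  obtain ⟨start, hs⟩ := hmax (fun α => ∑ s, (M.init s).toReal * v α s)
    (continuous_finsetSum _ fun s _ =>
      continuous_const.mul ((continuous_apply s).comp v.continuous))
  refine ⟨v, star v, start, ⟨‖v‖, fun α s => ?_⟩, fun α s => ?_, fun α s => hstar v s α, hs⟩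
  · rw [← Real.norm_eq_abs]
    exact (norm_le_pi_norm (v α) s).trans (v.norm_coe_le_norm α)
  · conv_lhs => rw [← hfix]
    rfl

end FixedPoint

/-! ### Plans and histories along a fixed state sequence -/

section Path

variable {S A : Type*}

/-- The control actions that the decoder takes from time `n` on, given the observations `o` and
control actions `a` before, if nothing is transmitted any more. -/
def silentSeq (d : DecPolicy S A) : (k : ℕ) → (n : ℕ) → (Fin n → Option S) → (Fin n → A) → A
  | 0, n, o, a => d n (Fin.snoc o none) a
  | k + 1, n, o, a =>
    silentSeq d k (n + 1) (Fin.snoc o none) (Fin.snoc a (d n (Fin.snoc o none) a))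

/-- The observations before time `t` along the state sequence `ω`. -/
def obsHist (e : EncPolicy S A) (d : DecPolicy S A) (ω : ℕ → S) (t : ℕ) : Fin t → Option S :=
  fun i => obs (ω i) ((actions e d ω t).1 i)

/-- The control actions that the decoder takes from time `t` on along the state sequence `ω`, if
nothing is transmitted from time `t` on. -/
def contSeq (e : EncPolicy S A) (d : DecPolicy S A) (ω : ℕ → S) (t : ℕ) : ℕ → A :=
  fun k => silentSeq d k t (obsHist e d ω t) (actions e d ω t).2

variable (e : EncPolicy S A) (d : DecPolicy S A)

lemma obsHist_eq (ω : ℕ → S) (t : ℕ) :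
    obsHist e d ω t = fun i : Fin t => obs (ω i) ((actions e d ω t).1 i) := rfl

lemma contSeq_eq (ω : ℕ → S) (t : ℕ) :
    contSeq e d ω t = fun k => silentSeq d k t (obsHist e d ω t) (actions e d ω t).2 := rfl

lemma comm_eq (ω : ℕ → S) (t : ℕ) :
    comm e d ω t = e t (fun i => ω i) (actions e d ω t).1 (actions e d ω t).2 := by
  simp [comm, actions, nextComm]

lemma obsHist_succ (ω : ℕ → S) (t : ℕ) :
    obsHist e d ω (t + 1) = Fin.snoc (obsHist e d ω t) (obs (ω t) (comm e d ω t)) := by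
  funext i
  refine Fin.lastCases ?_ (fun j => ?_) i
  · simp [obsHist, comm]
  · simp [obsHist, actions]

lemma ctrl_eq (ω : ℕ → S) (t : ℕ) :
    ctrl e d ω t = d t (Fin.snoc (obsHist e d ω t) (obs (ω t) (comm e d ω t)))
      (actions e d ω t).2 := by
  rw [← obsHist_succ]
  simp [ctrl, actions, nextCtrl, obsHist_eq]

lemma actions_snd_succ (ω : ℕ → S) (t : ℕ) :
    (actions e d ω (t + 1)).2 = Fin.snoc (actions e d ω t).2 (ctrl e d ω t) := by
  simp [ctrl, actions]

lemma contSeq_zero_of_not_comm {ω : ℕ → S} {t : ℕ} (h : comm e d ω t = false) :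
    contSeq e d ω t 0 = ctrl e d ω t := by
  rw [ctrl_eq, h]
  rfl

lemma contSeq_succ_of_not_comm {ω : ℕ → S} {t : ℕ} (h : comm e d ω t = false) (k : ℕ) :
    contSeq e d ω t (k + 1) = contSeq e d ω (t + 1) k := by
  rw [contSeq, contSeq, obsHist_succ, actions_snd_succ, ctrl_eq, h]
  rfl

lemma dependsOn_actions (t : ℕ) : DependsOn (fun ω => actions e d ω t) (Set.Iio t) := by
  intro x y h
  induction t with
  | zero => rfl
  | succ t ih =>
    have ih := ih fun i hi => h i (lt_trans hi t.lt_succ_self)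
    have hx : (fun i : Fin (t + 1) => x i) = fun i : Fin (t + 1) => y i :=
      funext fun i => h i i.2
    have hx' : ∀ i : Fin (t + 1), x i = y i := fun i => h i i.2
    simp only at ih
    simp only [actions, nextComm, nextCtrl, ih, hx']

lemma dependsOn_comm (t : ℕ) : DependsOn (fun ω => comm e d ω t) (Set.Iic t) := fun x y h => by
  have h1 := dependsOn_actions e d (t + 1) fun i hi => h i (Nat.lt_succ_iff.1 hi)
  simp only at h1
  simp only [comm, h1]

lemma dependsOn_ctrl (t : ℕ) : DependsOn (fun ω => ctrl e d ω t) (Set.Iic t) := fun x y h => by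
  have h1 := dependsOn_actions e d (t + 1) fun i hi => h i (Nat.lt_succ_iff.1 hi)
  simp only at h1
  simp only [ctrl, h1]

/-- The bound is strict: the plan at time t is settled before `s_t` is drawn, which is what lets the
Markov property apply to `v`. -/
lemma dependsOn_contSeq (t : ℕ) : DependsOn (fun ω => contSeq e d ω t) (Set.Iio t) :=
  fun x y h => by
    have h1 := dependsOn_actions e d t h
    have h2 : ∀ i : Fin t, x i = y i := fun i => h i i.2
    simp only at h1
    simp only [contSeq_eq, obsHist_eq, h1, h2]

lemma dependsOn_cont (v : (ℕ → A) → S → ℝ) (t : ℕ) :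
    DependsOn (fun ω => v (contSeq e d ω t) (ω t)) (Set.Iic t) := fun x y h => by
  have h1 := dependsOn_contSeq e d t fun i hi => h i (Set.mem_Iic.2 (Set.mem_Iio.1 hi).le)
  simp only at h1
  simp only [h1, h t Set.self_mem_Iic]

lemma extend_frestrictLe (ω : ℕ → S) {t i : ℕ} (h : i ≤ t) :
    extend (Preorder.frestrictLe (π := fun _ => S) t ω) i = ω i := by
  simp [extend, h]

lemma lastUpdate_snoc_none {n : ℕ} (o : Fin n → Option S) :
    lastUpdate (n + 1) (Fin.snoc o none) = ((lastUpdate n o).1 + 1, (lastUpdate n o).2) := by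
  simp [lastUpdate]

lemma lastUpdate_snoc_some {n : ℕ} (o : Fin n → Option S) (s : S) :
    lastUpdate (n + 1) (Fin.snoc o (some s)) = (0, some s) := by
  simp [lastUpdate]

/-- The `+ 1` counts the present silent step, matching the elapsed time given to the encoder, which
can thus compute the plan. -/
lemma silentSeq_reducedDec (g : ℕ → Option S → A) (k n : ℕ) (o : Fin n → Option S)
    (a : Fin n → A) :
    silentSeq (reducedDec g) k n o a = g ((lastUpdate n o).1 + 1 + k) (lastUpdate n o).2 := by
  induction k generalizing n with
  | zero => simp only [silentSeq, reducedDec, lastUpdate_snoc_none, add_zero]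
  | succ k ih =>
    rw [silentSeq, ih, lastUpdate_snoc_none, add_assoc _ 1 k, add_comm 1 k]

end Path

/-! ### Markov property of the state process -/

section Integration

variable {S A : Type*} [Fintype S] [MeasurableSpace S] [MeasurableSingletonClass S]

/-- Such a function factors through the finite set of histories up to time t. -/
lemma integrable_of_dependsOn {μ : Measure (ℕ → S)} [IsFiniteMeasure μ] {t : ℕ}
    {F : (ℕ → S) → ℝ} (hF : DependsOn F (Set.Iic t)) : Integrable F μ := by
  have h : F = (fun x => F (extend x)) ∘ Preorder.frestrictLe (π := fun _ => S) t :=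
    funext fun ω => hF fun i hi => (extend_frestrictLe ω hi).symm
  rw [h, ← integrable_map_measure Measurable.of_discrete.aestronglyMeasurable
    (by fun_prop)]
  exact Integrable.of_finite

instance (M : Model S A) (e : EncPolicy S A) (d : DecPolicy S A) :
    IsProbabilityMeasure (law M e d) := by
  unfold law
  infer_instance

lemma integral_law_zero (M : Model S A) (e : EncPolicy S A) (d : DecPolicy S A) (F : S → ℝ) :
    ∫ ω, F (ω 0) ∂law M e d = ∑ s, (M.init s).toReal * F s := by
  have h : (law M e d).map (fun ω => ω 0) = M.init.toMeasure := by
    have h1 : (fun ω : ℕ → S => ω 0) = (fun x : (i : Finset.Iic 0) → S => x ⟨0, by simp⟩) ∘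
        Preorder.frestrictLe (π := fun _ => S) 0 := rfl
    rw [h1, ← Measure.map_map (by fun_prop) (by fun_prop), law, Kernel.trajMeasure,
      Measure.map_comp _ _ (by fun_prop), Kernel.traj_map_frestrictLe, Kernel.partialTraj_self,
      Measure.id_comp, Measure.map_map (by fun_prop) (by fun_prop)]
    exact Measure.map_id
  rw [← integral_map (φ := fun ω : ℕ → S => ω 0) (f := F)
    (measurable_pi_apply 0).aemeasurable
    Measurable.of_discrete.aestronglyMeasurable, h, PMF.integral_eq_sum]
  rfl

/-- The Markov property: the conditional law of `s_{t+1}` given `s_0, …, s_t`. -/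
lemma integral_law_succ (M : Model S A) (e : EncPolicy S A) (d : DecPolicy S A) (t : ℕ)
    (H : (ℕ → S) → S → ℝ) (hH : ∀ s, DependsOn (H · s) (Set.Iic t)) :
    ∫ ω, H ω (ω (t + 1)) ∂law M e d =
      ∫ ω, ∑ s, (M.trans (ω t) (ctrl e d ω t) s).toReal * H ω s ∂law M e d := by
  have hr : ∀ ω s, H (extend (Preorder.frestrictLe (π := fun _ => S) t ω)) s = H ω s :=
    fun ω s => hH s fun i hi => extend_frestrictLe ω hi
  have hc : ∀ ω, ctrl e d (extend (Preorder.frestrictLe (π := fun _ => S) t ω)) t =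
      ctrl e d ω t := fun ω => dependsOn_ctrl e d t fun i hi => extend_frestrictLe ω hi
  let G : ((i : Finset.Iic t) → S) × S → ℝ := fun p => H (extend p.1) p.2
  have hG : Measurable G := Measurable.of_discrete
  have key := Kernel.map_frestrictLe_trajMeasure_compProd_eq_map_trajMeasure
    (X := fun _ => S) (μ₀ := M.init.toMeasure) (κ := stepKernel M e d) (a := t)
  change (law M e d).map _ ⊗ₘ _ = (law M e d).map _ at key
  calc ∫ ω, H ω (ω (t + 1)) ∂law M e d
      = ∫ ω, G (Preorder.frestrictLe (π := fun _ => S) t ω, ω (t + 1)) ∂law M e d := by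
        simp only [G, hr]
    _ = ∫ p, G p ∂((law M e d).map
          fun ω => (Preorder.frestrictLe (π := fun _ => S) t ω, ω (t + 1))) := by
        rw [integral_map (by fun_prop) hG.aestronglyMeasurable]
    _ = ∫ x, ∫ s, G (x, s) ∂stepKernel M e d t x
          ∂((law M e d).map (Preorder.frestrictLe (π := fun _ => S) t)) := by
        have : IsProbabilityMeasure
            ((law M e d).map (Preorder.frestrictLe (π := fun _ => S) t)) :=
          Measure.isProbabilityMeasure_map (by fun_prop)
        rw [← key, Measure.integral_compProd Integrable.of_finite]
    _ = ∫ ω, ∫ s, G (Preorder.frestrictLe (π := fun _ => S) t ω, s)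
          ∂stepKernel M e d t (Preorder.frestrictLe (π := fun _ => S) t ω) ∂law M e d := by
        rw [integral_map (by fun_prop) Measurable.of_discrete.aestronglyMeasurable]
    _ = _ := by
        refine integral_congr_ae (ae_of_all _ fun ω => ?_)
        change ∫ s, _ ∂(PMF.toMeasure _) = _
        rw [PMF.integral_eq_sum]
        simp only [G, hr, hc, extend_frestrictLe ω le_rfl, smul_eq_mul]

/-! ### Discounted telescoping -/

/-- The payoff at time `t` along the state sequence `ω`. -/
noncomputable def payoff (M : Model S A) (e : EncPolicy S A) (d : DecPolicy S A) (ω : ℕ → S)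
    (t : ℕ) : ℝ :=
  M.reward (ω t) (ctrl e d ω t) (ω (t + 1)) - M.β * (if comm e d ω t then 1 else 0)

variable (M : Model S A) (e : EncPolicy S A) (d : DecPolicy S A)

lemma integrable_payoff (t : ℕ) : Integrable (fun ω => payoff M e d ω t) (law M e d) :=
  integrable_of_dependsOn (t := t + 1) fun x y h => by
    have h' : ∀ i ∈ Set.Iic t, x i = y i := fun i hi => h i (le_trans hi t.le_succ)
    have h1 := dependsOn_ctrl e d t h'
    have h2 := dependsOn_comm e d t h'
    simp only at h1 h2
    simp only [payoff, h1, h2, h' t Set.self_mem_Iic, h (t + 1) Set.self_mem_Iic]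

/-- Payoffs are uniformly bounded, so geometric domination allows exchanging sum and integral. -/
lemma hasSum_value [Finite A] :
    HasSum (fun t => M.γ ^ t * ∫ ω, payoff M e d ω t ∂law M e d) (value M e d) := by
  obtain ⟨C, hC⟩ := (Set.finite_range fun p : S × A × S => |M.reward p.1 p.2.1 p.2.2|).bddAbove
  have hb : ∀ ω t, ‖payoff M e d ω t‖ ≤ C + M.β := fun ω t => by
    have h1 : |M.reward (ω t) (ctrl e d ω t) (ω (t + 1))| ≤ C :=
      hC ⟨(ω t, ctrl e d ω t, ω (t + 1)), rfl⟩
    have h2 := M.β_nonneg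
    rw [Real.norm_eq_abs, payoff]
    split_ifs
    · rw [abs_le] at h1 ⊢
      constructor <;> linarith [h1.1, h1.2]
    · rw [abs_le] at h1 ⊢
      constructor <;> linarith [h1.1, h1.2]
  have h := hasSum_integral_of_summable_integral_norm (μ := law M e d)
    (F := fun t ω => M.γ ^ t * payoff M e d ω t)
    (fun t => (integrable_payoff M e d t).const_mul _) ?_
  · simpa only [integral_const_mul] using! h
  · refine Summable.of_nonneg_of_le (fun t => integral_nonneg fun ω => norm_nonneg _)
      (fun t => ?_) ((summable_geometric_of_lt_one M.γ_nonneg M.γ_lt_one).mul_right (C + M.β))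
    have h2 : ∫ ω, ‖M.γ ^ t * payoff M e d ω t‖ ∂law M e d ≤
        ∫ _, M.γ ^ t * (C + M.β) ∂law M e d := by
      refine integral_mono ((integrable_payoff M e d t).const_mul _).norm (integrable_const _)
        fun ω => ?_
      have h0 := pow_nonneg M.γ_nonneg t
      simp only [norm_mul, Real.norm_of_nonneg h0]
      exact mul_le_mul_of_nonneg_left (hb ω t) h0
    simpa using h2

/-- Expectation of the continuation value `v` at time `t`. -/
noncomputable def meanCont (v : (ℕ → A) → S → ℝ) (t : ℕ) : ℝ :=
  ∫ ω, v (contSeq e d ω t) (ω t) ∂law M e d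

/-- The expected value of the decisions at time `t`, followed by the continuation value `v`. -/
noncomputable def decisionValue (v : (ℕ → A) → S → ℝ) (ω : ℕ → S) (t : ℕ) : ℝ :=
  stepValue M v (ctrl e d ω t) (contSeq e d ω (t + 1)) (ω t) -
    M.β * (if comm e d ω t then 1 else 0)

lemma integrable_decisionValue (v : (ℕ → A) → S → ℝ) (t : ℕ) :
    Integrable (fun ω => decisionValue M e d v ω t) (law M e d) :=
  integrable_of_dependsOn (t := t) fun x y h => by
    have h1 := dependsOn_ctrl e d t h
    have h2 := dependsOn_comm e d t h
    have h3 := dependsOn_contSeq e d (t + 1) fun i hi => h i (Nat.lt_succ_iff.1 hi)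
    simp only at h1 h2 h3
    simp only [decisionValue, h1, h2, h3, h t Set.self_mem_Iic]

lemma integral_payoff_add (v : (ℕ → A) → S → ℝ) (t : ℕ) :
    ∫ ω, payoff M e d ω t ∂law M e d + M.γ * meanCont M e d v (t + 1) =
      ∫ ω, decisionValue M e d v ω t ∂law M e d := by
  rw [meanCont, ← integral_const_mul, ← integral_add (integrable_payoff M e d t)
    ((integrable_of_dependsOn (dependsOn_cont e d v (t + 1))).const_mul _)]
  refine (integral_law_succ M e d t (fun ω s => M.reward (ω t) (ctrl e d ω t) s -
    M.β * (if comm e d ω t then 1 else 0) + M.γ * v (contSeq e d ω (t + 1)) s) ?_).trans ?_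
  · intro s x y h
    have h1 := dependsOn_ctrl e d t h
    have h2 := dependsOn_comm e d t h
    have h3 := dependsOn_contSeq e d (t + 1) fun i hi => h i (Nat.lt_succ_iff.1 hi)
    simp only at h1 h2 h3
    simp only [h1, h2, h3, h t Set.self_mem_Iic]
  · refine integral_congr_ae (ae_of_all _ fun ω => ?_)
    have h := sum_toReal_pmf (M.trans (ω t) (ctrl e d ω t))
    simp only [decisionValue, stepValue]
    generalize M.β * (if comm e d ω t = true then (1 : ℝ) else 0) = b
    conv_rhs => rw [← one_mul b, ← h, Finset.sum_mul, ← Finset.sum_sub_distrib]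
    exact Finset.sum_congr rfl fun s _ => by ring

/-- The partial sums telescope, and the remainder `γ ^ n * W n` vanishes because `W` is bounded. -/
lemma le_of_hasSum_discounted {γ V C : ℝ} (h0 : 0 ≤ γ) (h1 : γ < 1) {r W : ℕ → ℝ}
    (hV : HasSum (fun t => γ ^ t * r t) V) (hW : ∀ t, |W t| ≤ C)
    (h : ∀ t, r t + γ * W (t + 1) ≤ W t) : V ≤ W 0 := by
  have hn : ∀ n, ∑ t ∈ Finset.range n, γ ^ t * r t + γ ^ n * W n ≤ W 0 := fun n => by
    induction n with
    | zero => simp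
    | succ n ih =>
      rw [Finset.sum_range_succ, pow_succ]
      nlinarith [mul_le_mul_of_nonneg_left (h n) (pow_nonneg h0 n)]
  have hl : Tendsto (fun n => γ ^ n * W n) atTop (𝓝 0) :=
    (tendsto_pow_atTop_nhds_zero_of_lt_one h0 h1).zero_mul_isBoundedUnder_le
      (isBoundedUnder_of ⟨C, fun n => by simpa using hW n⟩)
  have := hV.tendsto_sum_nat.add hl
  rw [add_zero] at this
  exact le_of_tendsto' this hn

lemma abs_meanCont_le {v : (ℕ → A) → S → ℝ} {C : ℝ} (hv : ∀ α s, |v α s| ≤ C) (t : ℕ) :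
    |meanCont M e d v t| ≤ C := by
  have := norm_integral_le_of_norm_le_const (μ := law M e d)
    (f := fun ω => v (contSeq e d ω t) (ω t)) (C := C) (ae_of_all _ fun ω => hv _ _)
  simpa [meanCont] using this

/-- With an empty history the initial plan is deterministic and depends on `d` alone. -/
lemma meanCont_zero (v : (ℕ → A) → S → ℝ) :
    meanCont M e d v 0 =
      ∑ s, (M.init s).toReal * v (fun k => silentSeq d k 0 Fin.elim0 Fin.elim0) s := by
  rw [← integral_law_zero M e d, meanCont]
  refine integral_congr_ae (ae_of_all _ fun ω => ?_)
  have h : obsHist e d ω 0 = Fin.elim0 := Subsingleton.elim _ _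
  simp only [contSeq_eq, h]
  rfl

lemma value_le_of_decisionValue_le [Finite A] {v : (ℕ → A) → S → ℝ} {C : ℝ}
    (hv : ∀ α s, |v α s| ≤ C)
    (h : ∀ ω t, decisionValue M e d v ω t ≤ v (contSeq e d ω t) (ω t)) :
    value M e d ≤ meanCont M e d v 0 := by
  refine le_of_hasSum_discounted M.γ_nonneg M.γ_lt_one (hasSum_value M e d)
    (abs_meanCont_le M e d hv) fun t => ?_
  rw [integral_payoff_add]
  exact integral_mono (integrable_decisionValue M e d v t)
    (integrable_of_dependsOn (dependsOn_cont e d v t)) fun ω => h ω t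

lemma le_value_of_le_decisionValue [Finite A] {v : (ℕ → A) → S → ℝ} {C : ℝ}
    (hv : ∀ α s, |v α s| ≤ C)
    (h : ∀ ω t, v (contSeq e d ω t) (ω t) ≤ decisionValue M e d v ω t) :
    meanCont M e d v 0 ≤ value M e d := by
  have hV := (hasSum_value M e d).neg
  simp only [← mul_neg] at hV
  refine neg_le_neg_iff.1 (le_of_hasSum_discounted (W := fun t => -meanCont M e d v t)
    M.γ_nonneg M.γ_lt_one hV (fun t => by simpa using abs_meanCont_le M e d hv t) fun t => ?_)
  have h1 := integral_payoff_add M e d v t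
  have h2 : meanCont M e d v t ≤ _ := integral_mono
    (integrable_of_dependsOn (dependsOn_cont e d v t)) (integrable_decisionValue M e d v t)
    fun ω => h ω t
  linarith

end Integration

/-! ### Upper bound for all policies, attained by the greedy pair -/

section Optimality

variable {S A : Type*} [Fintype S] {M : Model S A} {v : (ℕ → A) → S → ℝ} {star : S → ℕ → A}

lemma decisionValue_of_not_comm {e : EncPolicy S A} {d : DecPolicy S A} {ω : ℕ → S} {t : ℕ}
    (hc : comm e d ω t = false) :
    decisionValue M e d v ω t = seqValue M v (contSeq e d ω t) (ω t) := by
  simp only [decisionValue, hc, seqValue, contSeq_zero_of_not_comm e d hc,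
    contSeq_succ_of_not_comm e d hc]
  simp

lemma decisionValue_le
    (hmax : ∀ α s, v α s = max (seqValue M v (star s) s - M.β) (seqValue M v α s))
    (hstar : ∀ α s, seqValue M v α s ≤ seqValue M v (star s) s)
    (e : EncPolicy S A) (d : DecPolicy S A) (ω : ℕ → S) (t : ℕ) :
    decisionValue M e d v ω t ≤ v (contSeq e d ω t) (ω t) := by
  rw [hmax]
  cases hc : comm e d ω t with
  | false =>
    rw [decisionValue_of_not_comm hc]
    exact le_max_right _ _
  | true =>
    refine le_trans ?_ (le_max_left _ _)
    have h : stepValue M v (ctrl e d ω t) (contSeq e d ω (t + 1)) (ω t) ≤ _ :=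
      -- The present action followed by the next plan is itself a plan, so `star` dominates it.
      hstar (fun n => Nat.casesOn n (ctrl e d ω t) (contSeq e d ω (t + 1))) (ω t)
    simpa [decisionValue, hc] using h

/-- The decoder map that after a transmission of `s` plays `star s`, and `start` before the first
transmission. -/
def seqDec (star : S → ℕ → A) (start : ℕ → A) (k : ℕ) : Option S → A
  | some s => star s k
  -- Before any transmission the elapsed time at t is t + 1, hence the shift.
  | none => start (k - 1)

open Classical in
/-- The encoder map that transmits if and only if the gain from a transmission covers its price,
when the decoder applies the map `g`. -/
noncomputable def greedyEnc (M : Model S A) (v : (ℕ → A) → S → ℝ) (star : S → ℕ → A)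
    (g : ℕ → Option S → A) (s : S) (k : ℕ) (x : Option S) : Bool :=
  decide (seqValue M v (fun j => g (k + j) x) s ≤ seqValue M v (star s) s - M.β)

lemma le_decisionValue_greedy
    (hmax : ∀ α s, v α s = max (seqValue M v (star s) s - M.β) (seqValue M v α s))
    (start : ℕ → A) (ω : ℕ → S) (t : ℕ) :
    let e := reducedEnc (greedyEnc M v star (seqDec star start))
    let d := reducedDec (seqDec star start)
    v (contSeq e d ω t) (ω t) ≤ decisionValue M e d v ω t := by
  intro e d
  -- The sequence that the greedy encoder tests is exactly the decoder's current plan.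
  have hcomm : comm e d ω t = true ↔
      seqValue M v (contSeq e d ω t) (ω t) ≤ seqValue M v (star (ω t)) (ω t) - M.β := by
    rw [comm_eq]
    simp only [contSeq_eq, d, silentSeq_reducedDec]
    simp [e, reducedEnc, greedyEnc, obsHist_eq]
  rw [hmax]
  cases hc : comm e d ω t with
  | false =>
    rw [hc] at hcomm
    rw [decisionValue_of_not_comm hc]
    exact max_le (le_of_lt (not_le.1 (mt hcomm.2 (by simp)))) le_rfl
  | true =>
    have h1 : ctrl e d ω t = star (ω t) 0 := by
      simp [ctrl_eq, hc, obs, d, reducedDec, lastUpdate_snoc_some, seqDec]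
    have h2 : contSeq e d ω (t + 1) = fun k => star (ω t) (k + 1) := by
      funext k
      simp [contSeq, d, silentSeq_reducedDec, obsHist_succ]
      simp [show comm e (reducedDec (seqDec star start)) ω t = true from hc, obs,
        lastUpdate_snoc_some, seqDec, add_comm]
    rw [max_eq_left (hcomm.1 hc), decisionValue, h1, h2, hc, if_pos rfl, mul_one]
    rfl

end Optimality

end RemoteControl

theorem mainTheorem7 {S A : Type*} [Finite S] [MeasurableSpace S] [MeasurableSingletonClass S]
    [Finite A] [Nonempty A] (M : RemoteControl.Model S A) :
    ∃ (f : S → ℕ → Option S → Bool) (g : ℕ → Option S → A),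
      ∀ (e : RemoteControl.EncPolicy S A) (d : RemoteControl.DecPolicy S A),
        RemoteControl.value M e d ≤
          RemoteControl.value M (RemoteControl.reducedEnc f) (RemoteControl.reducedDec g) := by
  open RemoteControl in
  cases nonempty_fintype S
  obtain ⟨v, star, start, ⟨C, hC⟩, hmax, hstar, hstart⟩ := exists_optimality_equation M
  refine ⟨greedyEnc M v star (seqDec star start), seqDec star start, fun e d => ?_⟩
  refine (value_le_of_decisionValue_le M e d hC (decisionValue_le hmax hstar e d)).trans
    (le_trans ?_ (le_value_of_le_decisionValue M _ _ hC (le_decisionValue_greedy hmax start)))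
  rw [meanCont_zero, meanCont_zero]
  refine (hstart _).trans (le_of_eq ?_)
  -- The initial plan of the reduced decoder is `start`.
  simp [silentSeq_reducedDec, lastUpdate, seqDec]
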